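/- Let $M$ be an $n$-dimensional manifold (Hausdorff, second countable, with maximal $C^\infty$ atlas $\mathcal A(M)$ of charts $\alpha:\mathrm{dom}(\alpha)\subset M\to\mathrm{ran}(\alpha)\subset\mathbb R^n$), let $g$ be a $C^l$ pseudo-Riemannian metric on $M$ (symmetric, non-degenerate), and let $0\le k\le l\le\infty$. **Boundary points.** An admissible boundary point of a chart $\alpha$ is a $p\in\partial\,\mathrm{ran}(\alpha)$ such that no sequence $(x_i)\subset\mathrm{dom}(\alpha)$ with $\alpha(x_i)\to p$ has an accumulation point in $M$; the set of these is $B(\alpha)$. For $U\subset\mathbb R^n$ open write $\partial_U\mathrm{ran}(\alpha)=U\cap\partial\,\mathrm{ran}(\alpha)$. A pair $(\alpha,U)$ with $U$ open, $\mathrm{ran}(\alpha)\subset U$ and $\varnothing\ne\partial_U\mathrm{ran}(\alpha)\subset B(\alpha)$ is an extension; $\alpha$ is then called extendible, and it has a largest such $U$, denoted $U_\alpha$. A boundary set is a triple $(\alpha,U,V)$ with $(\alpha,U)$ an extension and $V\subset B(\alpha)\cap U$; it is a boundary point if $V=\{p\}$. The boundary set $(\alpha,U,V)$ covers $(\beta,X,Y)$,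 written $(\alpha,U,V)\rhd(\beta,X,Y)$, if every sequence $(y_i)\subset\mathrm{dom}(\beta)$ such that $(\beta(y_i))$ has an accumulation point in $Y$ has a subsequence $(v_i)\subset\mathrm{dom}(\alpha)$ such that $(\alpha(v_i))$ has an accumulation point in $V$. Two boundary sets are equivalent ($\equiv$) if each covers the other. **The chart induced boundary.** For the pairs $(\alpha,\mathrm{ran}(\alpha))$, $\alpha\in\mathcal A(M)$, and $(\alpha,U_\alpha)$, $\alpha$ extendible, put $N_{(\alpha,U)}=\mathrm{ran}(\alpha)\cup\partial_U\mathrm{ran}(\alpha)$. The completion of $M$ is the quotient space of the disjoint union of all these $N_{(\alpha,U)}$ by the equivalence relation that identifies $x\in N_{(\alpha,U)}$ with $y\in N_{(\beta,X)}$ if either $x\in\mathrm{ran}(\alpha)$, $y\in\mathrm{ran}(\beta)$, $\beta\circ\alpha^{-1}(x)=y$, or $x\in\partial_U\mathrm{ran}(\alpha)$, $y\in\partial_X\mathrm{ran}(\beta)$, $(\alpha,U,\{x\})\equiv(\beta,X,\{y\})$. Let $\imath(m)=[\alpha(m)]$ for $m\in\mathrm{dom}(\alpha)$, and let $\mathcal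 B(M)=\partial\,\imath(M)$, the topological boundary of $\imath(M)$ in the completion. Every boundary point $(\alpha,U,\{p\})$ defines an element $[(\alpha,U,\{p\})]\in\mathcal B(M)$, the class of $p\in\partial_{U_\alpha}\mathrm{ran}(\alpha)$. **Curves.** A curve is a continuous, piecewise $C^1$ map $\gamma:I\to M$ on an interval $I\subset\mathbb R$ with more than one point; it is bounded if $I$ is bounded above. Let $\mathcal C$ be a set of curves with the bounded parameter property: every point of $M$ lies on some $\gamma\in\mathcal C$; every restriction of a $\gamma\in\mathcal C$ to a subinterval is in $\mathcal C$; and if $\gamma,\delta\in\mathcal C$ and $\delta=\gamma\circ s$ with $s$ an increasing $C^1$ function from the interval of $\delta$ onto that of $\gamma$, then $\gamma,\delta$ are both bounded or both unbounded. A curve $\gamma$ approaches $(\alpha,U,\{p\})$ if $p\in\overline{\alpha(\gamma\cap\mathrm{dom}(\alpha))}$. **Classes of boundary points.** A boundary point $b=(\alpha,U,\{p\})$ is * approachable if some $\gamma\in\mathcal C$ approaches it, otherwise unapproachable; * $C^k$ regular if there are an open $V$ with $p\in V\subset U$ and a $C^k$ pseudo-Riemannian metric on $V$ that equals $(\alpha^{-1})^*g$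 on $\mathrm{ran}(\alpha)\cap V$; * a $C^k$ point at infinity if it is not $C^k$ regular, is approachable, and every $\gamma\in\mathcal C$ that approaches it is unbounded; * a $C^k$ singularity if it is not $C^k$ regular and some bounded $\gamma\in\mathcal C$ approaches it; * a removable $C^k$ point at infinity if it is a $C^k$ point at infinity and is covered by a boundary set $(\beta,X,Y)$ such that $(\beta,X,\{y\})$ is $C^k$ regular for all $y\in Y$; * a removable $C^k$ singularity if it is a $C^k$ singularity and is covered by a boundary set $(\beta,X,Y)$ such that, for all $y\in Y$, $(\beta,X,\{y\})$ is $C^k$ regular, a $C^k$ point at infinity or unapproachable; * essential if it is a $C^k$ point at infinity or a $C^k$ singularity and is not removable; * mixed if it is essential and covers some $C^k$ regular boundary point, and pure if it is essential and not mixed; * $C^k$ indeterminate if it is an approachable $C^k$ regular point, a removable $C^k$ point at infinity or a removable $C^k$ singularity. **Proposition.** The following classification of $\mathcal B(M)$ is well defined. An element $[(\alpha,U,\{p\})]\in\mathcal B(M)$ is 1. approachable if and only if $(\alpha,U,\{p\})$ is approachable; 2. $C^k$ indeterminate if and only if $(\alpha,U,\{p\})$ is $C^k$ indeterminate; 3.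 a $C^k$ point at infinity if and only if $(\alpha,U,\{p\})$ is an essential $C^k$ point at infinity; 4. a $C^k$ singularity if and only if $(\alpha,U,\{p\})$ is an essential $C^k$ singularity; 5. mixed if and only if $(\alpha,U,\{p\})$ is mixed; 6. pure if and only if $(\alpha,U,\{p\})$ is pure. That is, for each of these six properties $P$ there is exactly one subset $S\subset\mathcal B(M)$ such that, for every boundary point $(\alpha,U,\{p\})$, $[(\alpha,U,\{p\})]\in S$ if and only if $(\alpha,U,\{p\})$ has $P$; in particular equivalent boundary points belong to the same classes. -/

import Mathlib

open Set Filter Topology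
open scoped Manifold ContDiff

noncomputable section

namespace ChartBoundary

/-- The model space `ℝⁿ`. -/
abbrev Model (n : ℕ) : Type := EuclideanSpace ℝ (Fin n)

section Boundary

variable (n : ℕ) (M : Type*) [TopologicalSpace M] [ChartedSpace (Model n) M]

/-- The maximal `C^∞` atlas of `M`. For a chart `α`, `α.source` is `dom α` and `α.target` is
`ran α`. -/
abbrev Atlas : Set (OpenPartialHomeomorph M (Model n)) :=
  IsManifold.maximalAtlas 𝓘(ℝ, Model n) ∞ M

variable {n M}

/-- The admissible boundary points of a chart `α`: the points `p` in the topological boundary of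
`ran α` such that no sequence in `dom α` whose image under `α` tends to `p` has an accumulation
point in `M`. -/
def admissible (α : OpenPartialHomeomorph M (Model n)) : Set (Model n) :=
  {p | p ∈ frontier α.target ∧
    ∀ x : ℕ → M, (∀ i, x i ∈ α.source) → Tendsto (fun i => α (x i)) atTop (𝓝 p) →
      ∀ m : M, ¬ MapClusterPt m atTop x}

/-- The boundary `∂_U ran α` of `ran α` relative to an open set `U` of `ℝⁿ`. -/
def relBoundary (α : OpenPartialHomeomorph M (Model n)) (U : Set (Model n)) : Set (Model n) :=
  U ∩ frontier α.target

/-- `(α, U)` is an extension. -/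
structure IsExtension (α : OpenPartialHomeomorph M (Model n)) (U : Set (Model n)) : Prop where
  mem_atlas : α ∈ Atlas n M
  isOpen : IsOpen U
  target_subset : α.target ⊆ U
  nonempty : (relBoundary α U).Nonempty
  subset_admissible : relBoundary α U ⊆ admissible α

variable (n M) in
/-- A boundary set `(α, U, V)`. -/
structure BoundarySet where
  chart : OpenPartialHomeomorph M (Model n)
  U : Set (Model n)
  isExtension : IsExtension chart U
  V : Set (Model n)
  subset : V ⊆ admissible chart ∩ U

variable (n M) in
/-- A boundary point `(α, U, {p})`. -/
structure BoundaryPoint where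
  chart : OpenPartialHomeomorph M (Model n)
  U : Set (Model n)
  isExtension : IsExtension chart U
  p : Model n
  mem : p ∈ admissible chart ∩ U

/-- A boundary point is a boundary set with one element. -/
def BoundaryPoint.toSet (b : BoundaryPoint n M) : BoundarySet n M :=
  ⟨b.chart, b.U, b.isExtension, {b.p}, by simpa using b.mem⟩

/-- The boundary point `(β, X, {y})` given by an element `y` of a boundary set `(β, X, Y)`. -/
def BoundarySet.point (B : BoundarySet n M) (y : Model n) (hy : y ∈ B.V) : BoundaryPoint n M :=
  ⟨B.chart, B.U, B.isExtension, y, B.subset hy⟩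

/-- The covering relation: every sequence in `dom β` whose image under `β` has an accumulation
point in `Y` has a subsequence in `dom α` whose image under `α` has an accumulation point
in `V`. -/
def CoversVia (α : OpenPartialHomeomorph M (Model n)) (V : Set (Model n))
    (β : OpenPartialHomeomorph M (Model n)) (Y : Set (Model n)) : Prop :=
  ∀ y : ℕ → M, (∀ i, y i ∈ β.source) →
    (∃ q ∈ Y, MapClusterPt q atTop (fun i => β (y i))) →
    ∃ φ : ℕ → ℕ, StrictMono φ ∧ (∀ i, y (φ i) ∈ α.source) ∧
      ∃ p ∈ V, MapClusterPt p atTop (fun i => α (y (φ i)))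

/-- `A ▷ B` for boundary sets. -/
def BoundarySet.Covers (A B : BoundarySet n M) : Prop :=
  CoversVia A.chart A.V B.chart B.V

/-- `A ≡ B` for boundary sets. -/
def BoundarySet.Equivalent (A B : BoundarySet n M) : Prop :=
  A.Covers B ∧ B.Covers A

theorem CoversVia.refl (α : OpenPartialHomeomorph M (Model n)) (V : Set (Model n)) :
    CoversVia α V α V :=
  fun _ hy h => ⟨id, strictMono_id, hy, h⟩

theorem CoversVia.trans {α β δ : OpenPartialHomeomorph M (Model n)} {V Y Z : Set (Model n)}
    (h₁ : CoversVia α V β Y) (h₂ : CoversVia β Y δ Z) : CoversVia α V δ Z := by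
  intro z hz hZ
  obtain ⟨φ, hφ, hφs, hY⟩ := h₂ z hz hZ
  obtain ⟨ψ, hψ, hψs, hV⟩ := h₁ (fun i => z (φ i)) hφs hY
  exact ⟨φ ∘ ψ, hφ.comp hψ, hψs, hV⟩

/-! ### The completion of `M` by a set of extensions -/

variable (n M) in
/-- Pairs of a chart of `M` and a subset of `ℝⁿ`. -/
abbrev ChartPair := OpenPartialHomeomorph M (Model n) × Set (Model n)

variable (n M) in
/-- The set of all extensions. -/
def EX : Set (ChartPair n M) := {P | IsExtension P.1 P.2}

variable (n M) in
/-- The trivial extensions `(α, ran α)`. -/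
def trivialPairs : Set (ChartPair n M) := {P | P.1 ∈ Atlas n M ∧ P.2 = P.1.target}

/-- `S_Q`, the union of the trivial extensions and `Q`. -/
def indexSet (Q : Set (ChartPair n M)) : Set (ChartPair n M) := trivialPairs n M ∪ Q

/-- `N_{(α, U)} = ran α ∪ ∂_U ran α`. -/
def piece (P : ChartPair n M) : Set (Model n) := P.1.target ∪ relBoundary P.1 P.2

/-- `N_Q`, the disjoint union of the `N_{(α, U)}`, with the disjoint union topology. -/
abbrev PieceUnion (Q : Set (ChartPair n M)) := Σ P : indexSet Q, piece P.1

/-- The relation on `N_Q`: either the two points are related by the change of coordinates, or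
they are equivalent boundary points. -/
def gluing {Q : Set (ChartPair n M)} (a b : PieceUnion Q) : Prop :=
  let α := a.1.1.1
  let β := b.1.1.1
  let x : Model n := a.2.1
  let y : Model n := b.2.1
  (x ∈ α.target ∧ y ∈ β.target ∧ α.symm x ∈ β.source ∧ β (α.symm x) = y) ∨
  (x ∈ relBoundary α a.1.1.2 ∧ y ∈ relBoundary β b.1.1.2 ∧
    CoversVia α {x} β {y} ∧ CoversVia β {y} α {x})

theorem not_mem_target_of_mem_relBoundary {α : OpenPartialHomeomorph M (Model n)}
    {U : Set (Model n)} {x : Model n} (hx : x ∈ relBoundary α U) : x ∉ α.target := by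
  have h := hx.2
  rw [α.open_target.frontier_eq] at h
  exact h.2

theorem gluing_equivalence (Q : Set (ChartPair n M)) :
    Equivalence (gluing : PieceUnion Q → PieceUnion Q → Prop) where
  refl := by
    rintro ⟨P, x, hx⟩
    rcases hx with hx | hx
    · exact Or.inl ⟨hx, hx, P.1.1.map_target hx, P.1.1.right_inv hx⟩
    · exact Or.inr ⟨hx, hx, CoversVia.refl _ _, CoversVia.refl _ _⟩
  symm := by
    rintro a b (⟨h₁, h₂, h₃, h₄⟩ | ⟨h₁, h₂, h₃, h₄⟩)
    · refine Or.inl ⟨h₂, h₁, ?_, ?_⟩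
      · rw [← h₄, b.1.1.1.left_inv h₃]
        exact a.1.1.1.map_target h₁
      · rw [← h₄, b.1.1.1.left_inv h₃]
        exact a.1.1.1.right_inv h₁
    · exact Or.inr ⟨h₂, h₁, h₄, h₃⟩
  trans := by
    rintro a b c (⟨h₁, h₂, h₃, h₄⟩ | ⟨h₁, h₂, h₃, h₄⟩)
      (⟨k₁, k₂, k₃, k₄⟩ | ⟨k₁, k₂, k₃, k₄⟩)
    · have hb : b.1.1.1.symm b.2.1 = a.1.1.1.symm a.2.1 := by
        rw [← h₄, b.1.1.1.left_inv h₃]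
      rw [hb] at k₃ k₄
      exact Or.inl ⟨h₁, k₂, k₃, k₄⟩
    · exact absurd h₂ (not_mem_target_of_mem_relBoundary k₁)
    · exact absurd k₁ (not_mem_target_of_mem_relBoundary h₂)
    · exact Or.inr ⟨h₁, k₂, h₃.trans k₃, k₄.trans h₄⟩

/-- The equivalence relation on `N_Q`. -/
def gluingSetoid (Q : Set (ChartPair n M)) : Setoid (PieceUnion Q) :=
  ⟨gluing, gluing_equivalence Q⟩

/-- The completion `Q(M)` of `M` with respect to `Q`. -/
def Completion (Q : Set (ChartPair n M)) : Type _ := Quotient (gluingSetoid Q)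

/-- The quotient topology on `Q(M)`. -/
instance (Q : Set (ChartPair n M)) : TopologicalSpace (Completion Q) :=
  inferInstanceAs (TopologicalSpace (Quotient (gluingSetoid Q)))

/-- The quotient map `q : N_Q → Q(M)`. -/
def quotientMap (Q : Set (ChartPair n M)) (a : PieceUnion Q) : Completion Q :=
  Quotient.mk (gluingSetoid Q) a

/-- The map `ι_Q : M → Q(M)`, `x ↦ [α(x)]`, where `α` is a chart with `x ∈ dom α`. -/
def inclusion (Q : Set (ChartPair n M)) [IsManifold 𝓘(ℝ, Model n) ∞ M] (x : M) : Completion Q :=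
  quotientMap Q ⟨⟨(chartAt (Model n) x, (chartAt (Model n) x).target),
    Or.inl ⟨IsManifold.chart_mem_maximalAtlas x, rfl⟩⟩,
    ⟨chartAt (Model n) x x, Or.inl (mem_chart_target (Model n) x)⟩⟩

/-- The value `[α(x)]` does not depend on the chart `α` with `x ∈ dom α`. -/
theorem inclusion_eq (Q : Set (ChartPair n M)) [IsManifold 𝓘(ℝ, Model n) ∞ M] (x : M)
    (P : indexSet Q) (hx : x ∈ P.1.1.source) :
    inclusion Q x = quotientMap Q ⟨P, ⟨P.1.1 x, Or.inl (P.1.1.map_source hx)⟩⟩ := by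
  refine Quotient.sound (s := gluingSetoid Q) (Or.inl ⟨mem_chart_target _ x,
    P.1.1.map_source hx, ?_, ?_⟩)
  · simpa [(chartAt (Model n) x).left_inv (mem_chart_source _ x)] using hx
  · simp [(chartAt (Model n) x).left_inv (mem_chart_source _ x)]

/-! ### The coordinate independent chart induced boundary -/

variable (n M) in
/-- The pairs `(α, U_α)` with `α` extendible and `U_α` its largest extension. -/
def maximalExtensions : Set (ChartPair n M) :=
  {P | P ∈ EX n M ∧ ∀ U, (P.1, U) ∈ EX n M → U ⊆ P.2}

/-- The union of all extensions of a chart. -/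
def unionExtension (α : OpenPartialHomeomorph M (Model n)) : Set (Model n) :=
  ⋃₀ {U | IsExtension α U}

theorem unionExtension_mem {α : OpenPartialHomeomorph M (Model n)} {U : Set (Model n)}
    (h : IsExtension α U) : (α, unionExtension α) ∈ maximalExtensions n M := by
  have hsub : ∀ W, IsExtension α W → W ⊆ unionExtension α :=
    fun W hW => subset_sUnion_of_mem hW
  refine ⟨⟨h.mem_atlas, isOpen_sUnion fun W hW => hW.isOpen,
    h.target_subset.trans (hsub U h), ?_, ?_⟩, hsub⟩
  · obtain ⟨x, hx⟩ := h.nonempty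
    exact ⟨x, hsub U h hx.1, hx.2⟩
  · rintro x ⟨⟨W, hW, hxW⟩, hx⟩
    exact hW.subset_admissible ⟨hxW, hx⟩

variable (n M) in
/-- The boundary `∂ι(M)` of `M` in its completion by all maximal extensions. -/
def boundary [IsManifold 𝓘(ℝ, Model n) ∞ M] : Set (Completion (maximalExtensions n M)) :=
  frontier (range (inclusion (maximalExtensions n M)))

/-- The image in the completion of a boundary point `(α, U, {p})`: the class of `p`, as an
element of `∂_{U_α} ran α`. -/
def BoundaryPoint.toCompletion (b : BoundaryPoint n M) : Completion (maximalExtensions n M) :=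
  quotientMap _ ⟨⟨(b.chart, unionExtension b.chart), Or.inr (unionExtension_mem b.isExtension)⟩,
    ⟨b.p, Or.inr ⟨(unionExtension_mem b.isExtension).2 b.U b.isExtension b.mem.2, b.mem.1.1⟩⟩⟩

theorem BoundaryPoint.toCompletion_mem [IsManifold 𝓘(ℝ, Model n) ∞ M] (b : BoundaryPoint n M) :
    b.toCompletion ∈ boundary n M := by
  set P : indexSet (maximalExtensions n M) :=
    ⟨(b.chart, unionExtension b.chart), Or.inr (unionExtension_mem b.isExtension)⟩ with hP
  have hp : b.p ∈ relBoundary b.chart (unionExtension b.chart) :=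
    ⟨(unionExtension_mem b.isExtension).2 b.U b.isExtension b.mem.2, b.mem.1.1⟩
  let f : piece P.1 → Completion (maximalExtensions n M) := fun x => quotientMap _ ⟨P, x⟩
  have hf : Continuous f := continuous_quotient_mk'.comp continuous_sigmaMk
  have hnot : b.toCompletion ∉ range (inclusion (maximalExtensions n M)) := by
    rintro ⟨x, hx⟩
    rcases Quotient.exact (s := gluingSetoid _) hx with h | h
    · exact not_mem_target_of_mem_relBoundary hp h.2.1
    · exact not_mem_target_of_mem_relBoundary h.1 (mem_chart_target (Model n) x)
  refine ⟨?_, fun h => hnot (interior_subset h)⟩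
  have hcl : (⟨b.p, Or.inr hp⟩ : piece P.1) ∈
      closure {x : piece P.1 | (x : Model n) ∈ b.chart.target} := by
    rw [closure_subtype]
    have hpc : b.p ∈ closure b.chart.target := b.mem.1.1.1
    refine closure_mono ?_ hpc
    intro y hy
    exact ⟨⟨y, Or.inl hy⟩, hy, rfl⟩
  have hmaps : MapsTo f {x : piece P.1 | (x : Model n) ∈ b.chart.target}
      (range (inclusion (maximalExtensions n M))) := by
    intro x hx
    refine ⟨b.chart.symm x, ?_⟩
    rw [inclusion_eq _ _ P (b.chart.map_target hx)]
    have : P.1.1 (b.chart.symm x) = x := b.chart.right_inv hx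
    simp only [f]
    congr 2
    exact Subtype.ext this
  exact hmaps.closure hf hcl

/-- The class `[(α, U, {p})]` in the chart induced boundary of `M`. -/
def BoundaryPoint.cls [IsManifold 𝓘(ℝ, Model n) ∞ M] (b : BoundaryPoint n M) : boundary n M :=
  ⟨b.toCompletion, b.toCompletion_mem⟩

/-- A class of boundary points `(α, U, {p})` is well defined on the chart induced boundary: there
is exactly one set of elements `[(α, U, {p})]` of that boundary for which membership of
`[(α, U, {p})]` is decided by whether `(α, U, {p})` is in the class, whatever the
representative. -/
def WellDefined [IsManifold 𝓘(ℝ, Model n) ∞ M] (P : BoundaryPoint n M → Prop) : Prop :=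
  ∃! S : Set (boundary n M), ∀ b : BoundaryPoint n M, b.cls ∈ S ↔ P b

end Boundary

section Curves

variable (n : ℕ) (M : Type*) [TopologicalSpace M] [ChartedSpace (Model n) M]

/-- A parametrized curve: a continuous, piecewise `C¹` function on an interval `I`. Only the
values of `toFun` on `I` matter. Piecewise `C¹`: every compact subinterval of `I` is cut by
finitely many points into closed intervals on which the function is `C¹`. -/
structure Curve where
  I : Set ℝ
  ordConnected : I.OrdConnected
  nontrivial : I.Nontrivial
  toFun : ℝ → M
  continuousOn : ContinuousOn toFun I
  piecewise : ∀ a ∈ I, ∀ b ∈ I, ∃ t : Set ℝ, t.Finite ∧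
    ∀ c d, a ≤ c → c < d → d ≤ b → Disjoint (Ioo c d) t →
      ContMDiffOn 𝓘(ℝ, ℝ) 𝓘(ℝ, Model n) 1 toFun (Icc c d)

variable {n M}

/-- The image of a curve. -/
def Curve.image (γ : Curve n M) : Set M := γ.toFun '' γ.I

/-- A curve is bounded if its parameter is bounded from above. -/
def Curve.Bounded (γ : Curve n M) : Prop := BddAbove γ.I

/-- `δ` is a sub-curve of `γ`. -/
def Curve.IsSubcurve (δ γ : Curve n M) : Prop := δ.I ⊆ γ.I ∧ EqOn δ.toFun γ.toFun δ.I

/-- `δ` is obtained from `γ` by a change of parameter: an increasing `C¹` function `s` from the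
interval of `δ` onto the interval of `γ`. -/
def Curve.IsReparam (δ γ : Curve n M) : Prop :=
  ∃ s : ℝ → ℝ, StrictMonoOn s δ.I ∧ ContDiffOn ℝ 1 s δ.I ∧ s '' δ.I = γ.I ∧
    EqOn (γ.toFun ∘ s) δ.toFun δ.I

/-- The bounded parameter property of a set of curves. -/
structure HasBPP (C : Set (Curve n M)) : Prop where
  exists_mem : ∀ p : M, ∃ γ ∈ C, p ∈ γ.image
  subcurve : ∀ γ ∈ C, ∀ δ : Curve n M, δ.IsSubcurve γ → δ ∈ C
  reparam : ∀ γ ∈ C, ∀ δ ∈ C, δ.IsReparam γ → (δ.Bounded ↔ γ.Bounded)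

/-- The curve `γ` approaches the boundary point `(α, U, {p})`: `p` is in the closure of the image
under `α` of the part of `γ` in `dom α`. -/
def Curve.Approaches (γ : Curve n M) (b : BoundaryPoint n M) : Prop :=
  b.p ∈ closure (b.chart '' (γ.image ∩ b.chart.source))

end Curves

section Metric

variable (n : ℕ) (M : Type*) [TopologicalSpace M] [ChartedSpace (Model n) M]
  [IsManifold 𝓘(ℝ, Model n) ∞ M]

/-- A `C^l` pseudo-Riemannian metric on `M`. -/
structure PseudoMetric (l : ℕ∞) where
  form : ∀ x : M, TangentSpace 𝓘(ℝ, Model n) x →L[ℝ] TangentSpace 𝓘(ℝ, Model n) x →L[ℝ] ℝ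
  symm : ∀ x v w, form x v w = form x w v
  nondegenerate : ∀ x v, (∀ w, form x v w = 0) → v = 0
  contMDiff : ContMDiff 𝓘(ℝ, Model n)
    (𝓘(ℝ, Model n).prod 𝓘(ℝ, Model n →L[ℝ] Model n →L[ℝ] ℝ)) l
    (fun x => Bundle.TotalSpace.mk' (Model n →L[ℝ] Model n →L[ℝ] ℝ)
      (E := fun x : M => TangentSpace 𝓘(ℝ, Model n) x →L[ℝ] TangentSpace 𝓘(ℝ, Model n) x →L[ℝ] ℝ)
      x (form x))

variable {n M} {l : ℕ∞}

/-- The value at `y ∈ ran α` of the coordinate form `(α⁻¹)^* g` of the metric. -/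
def PseudoMetric.inChart (g : PseudoMetric n M l) (α : OpenPartialHomeomorph M (Model n))
    (y v w : Model n) : ℝ :=
  g.form (α.symm y) (mfderiv 𝓘(ℝ, Model n) 𝓘(ℝ, Model n) α.symm y v)
    (mfderiv 𝓘(ℝ, Model n) 𝓘(ℝ, Model n) α.symm y w)

/-- `(α, U, {p})` is `C^k` regular: on an open neighbourhood `V ⊆ U` of `p` there is a `C^k`
pseudo-Riemannian metric which agrees with `(α⁻¹)^* g` on `ran α ∩ V`. -/
def IsRegular (g : PseudoMetric n M l) (k : ℕ∞) (b : BoundaryPoint n M) : Prop :=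
  ∃ V : Set (Model n), IsOpen V ∧ b.p ∈ V ∧ V ⊆ b.U ∧
    ∃ h : Model n → Model n →L[ℝ] Model n →L[ℝ] ℝ,
      ContDiffOn ℝ k h V ∧
      (∀ y ∈ V, ∀ v w, h y v w = h y w v) ∧
      (∀ y ∈ V, ∀ v, (∀ w, h y v w = 0) → v = 0) ∧
      ∀ y ∈ b.chart.target ∩ V, ∀ v w, h y v w = g.inChart b.chart y v w

/-! ### The classification of boundary points -/

/-- Approachable boundary points. -/
def IsApproachable (C : Set (Curve n M)) (b : BoundaryPoint n M) : Prop :=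
  ∃ γ ∈ C, γ.Approaches b

/-- `C^k` points at infinity. -/
def IsPointAtInfinity (g : PseudoMetric n M l) (C : Set (Curve n M)) (k : ℕ∞)
    (b : BoundaryPoint n M) : Prop :=
  ¬ IsRegular g k b ∧ IsApproachable C b ∧ ∀ γ ∈ C, γ.Approaches b → ¬ γ.Bounded

/-- `C^k` singularities. -/
def IsSingularity (g : PseudoMetric n M l) (C : Set (Curve n M)) (k : ℕ∞)
    (b : BoundaryPoint n M) : Prop :=
  ¬ IsRegular g k b ∧ ∃ γ ∈ C, γ.Approaches b ∧ γ.Bounded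

/-- Removable `C^k` points at infinity: those covered by a boundary set all of whose elements are
`C^k` regular. -/
def IsRemovablePointAtInfinity (g : PseudoMetric n M l) (C : Set (Curve n M)) (k : ℕ∞)
    (b : BoundaryPoint n M) : Prop :=
  IsPointAtInfinity g C k b ∧ ∃ B : BoundarySet n M, B.Covers b.toSet ∧
    ∀ y (hy : y ∈ B.V), IsRegular g k (B.point y hy)

/-- Removable `C^k` singularities: those covered by a boundary set all of whose elements are
`C^k` regular, `C^k` points at infinity or unapproachable. -/
def IsRemovableSingularity (g : PseudoMetric n M l) (C : Set (Curve n M)) (k : ℕ∞)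
    (b : BoundaryPoint n M) : Prop :=
  IsSingularity g C k b ∧ ∃ B : BoundarySet n M, B.Covers b.toSet ∧
    ∀ y (hy : y ∈ B.V), IsRegular g k (B.point y hy) ∨
      IsPointAtInfinity g C k (B.point y hy) ∨ ¬ IsApproachable C (B.point y hy)

/-- Removable boundary points. -/
def IsRemovable (g : PseudoMetric n M l) (C : Set (Curve n M)) (k : ℕ∞)
    (b : BoundaryPoint n M) : Prop :=
  IsRemovablePointAtInfinity g C k b ∨ IsRemovableSingularity g C k b

/-- Essential `C^k` points at infinity. -/
def IsEssentialPointAtInfinity (g : PseudoMetric n M l) (C : Set (Curve n M)) (k : ℕ∞)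
    (b : BoundaryPoint n M) : Prop :=
  IsPointAtInfinity g C k b ∧ ¬ IsRemovable g C k b

/-- Essential `C^k` singularities. -/
def IsEssentialSingularity (g : PseudoMetric n M l) (C : Set (Curve n M)) (k : ℕ∞)
    (b : BoundaryPoint n M) : Prop :=
  IsSingularity g C k b ∧ ¬ IsRemovable g C k b

/-- Essential boundary points: the points at infinity and singularities that are not
removable. -/
def IsEssential (g : PseudoMetric n M l) (C : Set (Curve n M)) (k : ℕ∞)
    (b : BoundaryPoint n M) : Prop :=
  IsEssentialPointAtInfinity g C k b ∨ IsEssentialSingularity g C k b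

/-- Mixed boundary points: the essential ones that cover a `C^k` regular boundary point. -/
def IsMixed (g : PseudoMetric n M l) (C : Set (Curve n M)) (k : ℕ∞)
    (b : BoundaryPoint n M) : Prop :=
  IsEssential g C k b ∧ ∃ c : BoundaryPoint n M, IsRegular g k c ∧ b.toSet.Covers c.toSet

/-- Pure boundary points: the essential ones that are not mixed. -/
def IsPure (g : PseudoMetric n M l) (C : Set (Curve n M)) (k : ℕ∞)
    (b : BoundaryPoint n M) : Prop :=
  IsEssential g C k b ∧ ¬ IsMixed g C k b

/-- `C^k` indeterminate boundary points: the approachable `C^k` regular points and the removable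
`C^k` points at infinity and `C^k` singularities. -/
def IsIndeterminate (g : PseudoMetric n M l) (C : Set (Curve n M)) (k : ℕ∞)
    (b : BoundaryPoint n M) : Prop :=
  (IsRegular g k b ∧ IsApproachable C b) ∨ IsRemovablePointAtInfinity g C k b ∨
    IsRemovableSingularity g C k b

end Metric

end ChartBoundary

end

/-! A property of boundary points descends to the chart induced boundary once it is stable under
`≡`: boundary points with the same class are equivalent
(`BoundaryPoint.equivalent_of_toCompletion_eq`), which gives existence of the subset, and every
element of the boundary is such a class (`BoundaryPoint.cls_surjective`), which gives uniqueness.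

For stability, a curve approaching a boundary point carries a sequence converging to it in the
chart, so covering forces the curve to approach the covering point too
(`Curve.Approaches.of_covers`). Equivalent points are therefore approached by the same curves,
bounded or not. Being covered by a given boundary set is also preserved, by transitivity.

Only regularity is not transported, since it refers to the metric in one chart. The classes are
built to absorb this: a non-regular approachable point equivalent to a regular one is covered by it,
hence removable. So no essential point is equivalent to a regular one, and the indeterminate class
holds both. -/

namespace ChartBoundary

/-! ### Classes in the completion and the covering relation -/

section Completion

variable {n : ℕ} {M : Type*} [TopologicalSpace M] [ChartedSpace (Model n) M]

/-- Boundary points with the same image in the completion are equivalent. -/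
theorem BoundaryPoint.equivalent_of_toCompletion_eq {b c : BoundaryPoint n M}
    (h : b.toCompletion = c.toCompletion) : b.toSet.Equivalent c.toSet := by
  rcases Quotient.exact (s := gluingSetoid _) h with h | h
  · exact absurd h.1 (not_mem_target_of_mem_relBoundary (U := b.U) ⟨b.mem.2, b.mem.1.1⟩)
  · exact h.2.2

/-- The image of `M` in a completion is open. -/
theorem isOpen_range_inclusion [IsManifold 𝓘(ℝ, Model n) ∞ M] (Q : Set (ChartPair n M)) :
    IsOpen (range (inclusion Q)) := by
  have hq : IsQuotientMap (quotientMap Q) := isQuotientMap_quotient_mk'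
  rw [← hq.isOpen_preimage, isOpen_sigma_iff]
  intro P
  -- The gluing never identifies a point of a chart range with a relative boundary point, so on each
  -- piece the preimage is exactly the chart range.
  have heq : Sigma.mk P ⁻¹' (quotientMap Q ⁻¹' range (inclusion Q)) =
      ((↑) : piece P.1 → Model n) ⁻¹' P.1.1.target := by
    ext x
    constructor
    · rintro ⟨m, hm⟩
      rcases Quotient.exact (s := gluingSetoid Q) hm with h | h
      · exact h.2.1
      · exact absurd (mem_chart_target (Model n) m) (not_mem_target_of_mem_relBoundary h.1)
    · intro hx
      refine ⟨P.1.1.symm x, ?_⟩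
      rw [inclusion_eq Q _ P (P.1.1.map_target hx)]
      congr 2
      exact Subtype.ext (P.1.1.right_inv hx)
  rw [heq]
  exact P.1.1.open_target.preimage continuous_subtype_val

/-- Every element of the chart induced boundary is the class of a boundary point. -/
theorem BoundaryPoint.cls_surjective [IsManifold 𝓘(ℝ, Model n) ∞ M] :
    Function.Surjective (BoundaryPoint.cls : BoundaryPoint n M → boundary n M) := by
  rintro ⟨z, hz⟩
  obtain ⟨⟨P, x, hx⟩, rfl⟩ := Quotient.exists_rep z
  have hnot := hz.2
  rw [(isOpen_range_inclusion _).interior_eq] at hnot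
  rcases hx with hx | hx
  · refine absurd ⟨P.1.1.symm x, ?_⟩ hnot
    rw [inclusion_eq _ _ P (P.1.1.map_target hx)]
    change quotientMap _ _ = quotientMap _ _
    congr 2
    exact Subtype.ext (P.1.1.right_inv hx)
  · rcases P.2 with hP | hP
    -- A trivial extension has `U = ran α`, which is open and so misses its frontier: there are no
    -- relative boundary points.
    · exact absurd (hP.2 ▸ hx.1) (not_mem_target_of_mem_relBoundary hx)
    · refine ⟨⟨P.1.1, P.1.2, hP.1, x, hP.1.subset_admissible hx, hx.1⟩, Subtype.ext ?_⟩
      -- `toCompletion` places the point in the piece of `unionExtension`, formally a different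
      -- index from `P`; the two copies are glued because covering is reflexive.
      exact Quotient.sound (s := gluingSetoid _)
        (Or.inr ⟨⟨(unionExtension_mem hP.1).2 _ hP.1 hx.1, hx.2⟩, hx,
          CoversVia.refl _ _, CoversVia.refl _ _⟩)

/-- A class of boundary points that is stable under equivalence is well defined on the chart
induced boundary. -/
theorem wellDefined_of_equivalent [IsManifold 𝓘(ℝ, Model n) ∞ M] {P : BoundaryPoint n M → Prop}
    (hP : ∀ b c : BoundaryPoint n M, b.toSet.Equivalent c.toSet → P b → P c) :
    WellDefined P := by
  refine ⟨BoundaryPoint.cls '' {b | P b}, fun b => ⟨?_, fun hb => ⟨b, hb, rfl⟩⟩, ?_⟩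
  · rintro ⟨c, hc, hcb⟩
    exact hP c b (BoundaryPoint.equivalent_of_toCompletion_eq (congrArg Subtype.val hcb)) hc
  · intro S hS
    ext z
    constructor
    · intro hz
      obtain ⟨b, rfl⟩ := BoundaryPoint.cls_surjective z
      exact ⟨b, (hS b).1 hz, rfl⟩
    · rintro ⟨b, hb, rfl⟩
      exact (hS b).2 hb

theorem BoundarySet.Equivalent.symm {A B : BoundarySet n M} (h : A.Equivalent B) :
    B.Equivalent A :=
  ⟨h.2, h.1⟩

/-- A curve that approaches a boundary point approaches every boundary point covering it. -/
theorem Curve.Approaches.of_covers {γ : Curve n M} {b c : BoundaryPoint n M}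
    (h : γ.Approaches b) (hcb : c.toSet.Covers b.toSet) : γ.Approaches c := by
  obtain ⟨u, hu, hlim⟩ := mem_closure_iff_seq_limit.1 h
  choose x hx hxu using hu
  -- The sequence `x` runs along the curve, and its chart images converge to `b.p`; a subsequence
  -- then clusters at `c.p` in the other chart while staying on the curve.
  obtain ⟨φ, -, hφ, p, rfl, hp⟩ := hcb x (fun i => (hx i).2)
    ⟨b.p, rfl, Tendsto.mapClusterPt ((funext hxu : (fun i => b.chart (x i)) = u) ▸ hlim)⟩
  exact mem_closure_iff_clusterPt.2 (ClusterPt.mono hp (tendsto_principal.2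
    (Eventually.of_forall fun i => ⟨x (φ i), ⟨(hx _).1, hφ i⟩, rfl⟩)))

end Completion

/-! ### Stability of the classes under equivalence -/

section Classification

variable {n : ℕ} {M : Type*} [TopologicalSpace M] [ChartedSpace (Model n) M]
  [IsManifold 𝓘(ℝ, Model n) ∞ M] {l k : ℕ∞} {g : PseudoMetric n M l} {C : Set (Curve n M)}
  {b c : BoundaryPoint n M}

theorem IsApproachable.of_covers (h : IsApproachable C b) (hcb : c.toSet.Covers b.toSet) :
    IsApproachable C c :=
  let ⟨γ, hγ, hb⟩ := h
  ⟨γ, hγ, hb.of_covers hcb⟩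

/-- All elements of the boundary set given by a regular boundary point are regular. -/
theorem IsRegular.toSet_point (h : IsRegular g k b) (y : Model n) (hy : y ∈ b.toSet.V) :
    IsRegular g k (b.toSet.point y hy) := by
  obtain rfl : y = b.p := hy
  exact h

/-- Both directions of covering are needed: one makes `c` approachable, the other turns a curve
approaching `c` into one approaching `b`, hence unbounded. -/
theorem IsPointAtInfinity.of_equivalent (h : IsPointAtInfinity g C k b)
    (hbc : b.toSet.Equivalent c.toSet) (hc : ¬ IsRegular g k c) : IsPointAtInfinity g C k c :=
  ⟨hc, h.2.1.of_covers hbc.2, fun γ hγ hγc => h.2.2 γ hγ (hγc.of_covers hbc.1)⟩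

theorem IsSingularity.of_equivalent (h : IsSingularity g C k b)
    (hbc : b.toSet.Equivalent c.toSet) (hc : ¬ IsRegular g k c) : IsSingularity g C k c :=
  let ⟨γ, hγ, hγb, hbdd⟩ := h.2
  ⟨hc, γ, hγ, hγb.of_covers hbc.2, hbdd⟩

theorem IsSingularity.isApproachable (h : IsSingularity g C k b) : IsApproachable C b :=
  let ⟨γ, hγ, hγb, _⟩ := h.2
  ⟨γ, hγ, hγb⟩

/-- An approachable boundary point is regular, a point at infinity or a singularity. -/
theorem IsApproachable.cases (h : IsApproachable C b) (g : PseudoMetric n M l) (k : ℕ∞) :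
    IsRegular g k b ∨ IsPointAtInfinity g C k b ∨ IsSingularity g C k b := by
  by_cases hr : IsRegular g k b
  · exact Or.inl hr
  by_cases hs : ∃ γ ∈ C, γ.Approaches b ∧ γ.Bounded
  · exact Or.inr (Or.inr ⟨hr, hs⟩)
  · exact Or.inr (Or.inl ⟨hr, h, fun γ hγ hγb hbdd => hs ⟨γ, hγ, hγb, hbdd⟩⟩)

/-- A point at infinity covered by a regular boundary point is removable. -/
theorem IsPointAtInfinity.removable_of_regular (h : IsPointAtInfinity g C k b)
    (hc : IsRegular g k c) (hcb : c.toSet.Covers b.toSet) :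
    IsRemovablePointAtInfinity g C k b :=
  ⟨h, c.toSet, hcb, hc.toSet_point⟩

/-- A singularity covered by a regular boundary point is removable. -/
theorem IsSingularity.removable_of_regular (h : IsSingularity g C k b)
    (hc : IsRegular g k c) (hcb : c.toSet.Covers b.toSet) : IsRemovableSingularity g C k b :=
  ⟨h, c.toSet, hcb, fun y hy => Or.inl (hc.toSet_point y hy)⟩

theorem IsRemovablePointAtInfinity.of_equivalent (h : IsRemovablePointAtInfinity g C k b)
    (hbc : b.toSet.Equivalent c.toSet) (hc : ¬ IsRegular g k c) :
    IsRemovablePointAtInfinity g C k c :=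
  let ⟨B, hB, hreg⟩ := h.2
  ⟨h.1.of_equivalent hbc hc, B, hB.trans hbc.1, hreg⟩

theorem IsRemovableSingularity.of_equivalent (h : IsRemovableSingularity g C k b)
    (hbc : b.toSet.Equivalent c.toSet) (hc : ¬ IsRegular g k c) :
    IsRemovableSingularity g C k c :=
  let ⟨B, hB, hreg⟩ := h.2
  ⟨h.1.of_equivalent hbc hc, B, hB.trans hbc.1, hreg⟩

theorem IsRemovable.of_equivalent (h : IsRemovable g C k b)
    (hbc : b.toSet.Equivalent c.toSet) (hc : ¬ IsRegular g k c) : IsRemovable g C k c :=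
  h.imp (·.of_equivalent hbc hc) (·.of_equivalent hbc hc)

theorem IsIndeterminate.isApproachable (h : IsIndeterminate g C k b) : IsApproachable C b := by
  rcases h with h | h | h
  · exact h.2
  · exact h.1.2.1
  · exact h.1.isApproachable

theorem IsIndeterminate.of_equivalent (h : IsIndeterminate g C k b)
    (hbc : b.toSet.Equivalent c.toSet) : IsIndeterminate g C k c := by
  have hca : IsApproachable C c := h.isApproachable.of_covers hbc.2
  by_cases hc : IsRegular g k c
  · exact Or.inl ⟨hc, hca⟩
  rcases h with h | h
  -- Here `b` is regular and `c` is not, so `b` itself is the covering set that makes `c` removable.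
  · rcases hca.cases g k with hr | hi | hs
    · exact absurd hr hc
    · exact Or.inr (Or.inl (hi.removable_of_regular h.1 hbc.1))
    · exact Or.inr (Or.inr (hs.removable_of_regular h.1 hbc.1))
  · exact Or.inr (IsRemovable.of_equivalent h hbc hc)

/-- A regular `c` would cover `b` and make it removable, so `c` is not regular. Removability of `c`
would then pass back to the non-regular `b`. -/
theorem IsEssentialPointAtInfinity.of_equivalent (h : IsEssentialPointAtInfinity g C k b)
    (hbc : b.toSet.Equivalent c.toSet) : IsEssentialPointAtInfinity g C k c :=
  have hc : ¬ IsRegular g k c := fun hc => h.2 (Or.inl (h.1.removable_of_regular hc hbc.2))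
  ⟨h.1.of_equivalent hbc hc, fun hr => h.2 (hr.of_equivalent hbc.symm h.1.1)⟩

theorem IsEssentialSingularity.of_equivalent (h : IsEssentialSingularity g C k b)
    (hbc : b.toSet.Equivalent c.toSet) : IsEssentialSingularity g C k c :=
  have hc : ¬ IsRegular g k c := fun hc => h.2 (Or.inr (h.1.removable_of_regular hc hbc.2))
  ⟨h.1.of_equivalent hbc hc, fun hr => h.2 (hr.of_equivalent hbc.symm h.1.1)⟩

theorem IsEssential.of_equivalent (h : IsEssential g C k b)
    (hbc : b.toSet.Equivalent c.toSet) : IsEssential g C k c :=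
  h.imp (·.of_equivalent hbc) (·.of_equivalent hbc)

theorem IsMixed.of_equivalent (h : IsMixed g C k b)
    (hbc : b.toSet.Equivalent c.toSet) : IsMixed g C k c :=
  let ⟨d, hd, hbd⟩ := h.2
  ⟨h.1.of_equivalent hbc, d, hd, hbc.2.trans hbd⟩

theorem IsPure.of_equivalent (h : IsPure g C k b)
    (hbc : b.toSet.Equivalent c.toSet) : IsPure g C k c :=
  ⟨h.1.of_equivalent hbc, fun hm => h.2 (hm.of_equivalent hbc.symm)⟩

end Classification

end ChartBoundary

open scoped Manifold ContDiff in
theorem mainTheorem10 {n : ℕ} {M : Type*} [TopologicalSpace M] [T2Space M]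
    [SecondCountableTopology M] [ChartedSpace (ChartBoundary.Model n) M]
    [IsManifold 𝓘(ℝ, ChartBoundary.Model n) ∞ M]
    (k l : ℕ∞) (hkl : k ≤ l) (g : ChartBoundary.PseudoMetric n M l)
    (C : Set (ChartBoundary.Curve n M)) (hC : ChartBoundary.HasBPP C) :
    ChartBoundary.WellDefined
      (fun b : ChartBoundary.BoundaryPoint n M => ChartBoundary.IsApproachable C b) ∧
    ChartBoundary.WellDefined
      (fun b : ChartBoundary.BoundaryPoint n M => ChartBoundary.IsIndeterminate g C k b) ∧
    ChartBoundary.WellDefined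
      (fun b : ChartBoundary.BoundaryPoint n M =>
        ChartBoundary.IsEssentialPointAtInfinity g C k b) ∧
    ChartBoundary.WellDefined
      (fun b : ChartBoundary.BoundaryPoint n M =>
        ChartBoundary.IsEssentialSingularity g C k b) ∧
    ChartBoundary.WellDefined
      (fun b : ChartBoundary.BoundaryPoint n M => ChartBoundary.IsMixed g C k b) ∧
    ChartBoundary.WellDefined
      (fun b : ChartBoundary.BoundaryPoint n M => ChartBoundary.IsPure g C k b) := by
  exact ⟨ChartBoundary.wellDefined_of_equivalent fun _ _ hbc h => h.of_covers hbc.2,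
    ChartBoundary.wellDefined_of_equivalent fun _ _ hbc h => h.of_equivalent hbc,
    ChartBoundary.wellDefined_of_equivalent fun _ _ hbc h => h.of_equivalent hbc,
    ChartBoundary.wellDefined_of_equivalent fun _ _ hbc h => h.of_equivalent hbc,
    ChartBoundary.wellDefined_of_equivalent fun _ _ hbc h => h.of_equivalent hbc,
    ChartBoundary.wellDefined_of_equivalent fun _ _ hbc h => h.of_equivalent hbc⟩
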